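/- Let $d\in\mathbb N$, $I=\mathbb Z^d$, $E=\mathbb R^I$ (with its product topology and product $\sigma$-algebra), let $P$ be a Gaussian distribution on $E$ (a probability measure under which every continuous linear functional on $E$ is a possibly degenerate, not necessarily centered, real Gaussian variable), and let $\mathbb K=\mathbb R$ or $\mathbb C$. For $k\in\mathbb N$ and $x:\{1,\dots,k\}\to I$ let $\Psi(x)\in L^2(E,P;\mathbb K)$ be the class of the monomial $\phi\mapsto\prod_{i=1}^k\phi(x_i)$ (equal to $1$ if $k=0$). For an integer $m\ge -1$ let $H(m)$ be the closed linear span in $L^2(E,P;\mathbb K)$ of all $\Psi(x)$ with $x:\{1,\dots,k\}\to I$ and $k\le m$, so that $H(-1)=0$. For $m\in\mathbb N$ let $$S_m=H(m)\cap H(m-1)^\perp .$$ For a pairwise orthogonal family $(W_a)_{a\in A}$ of closed subspaces, write $\bigoplus^{\perp}_{a\in A}W_a$ for the closure of $\sum_{a\in A}W_a$. Then the closed subspaces $S_m$, $m\in\mathbb N$, are pairwise orthogonal, and $$H(m)=\bigoplus^{\perp}_{k\le m}S_k\quad\text{for every } m\in\mathbb N,\qquad L^2(E,P;\mathbb K)=\bigoplus^{\perp}_{m\in\mathbb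 N}S_m .$$ -/

import Mathlib

open MeasureTheory ProbabilityTheory

namespace GaussianChaos

/-- The configuration space `E = ℝ^I` with `I = ℤ^d`, with its product topology and product
σ-algebra. -/
abbrev Config (d : ℕ) : Type := (Fin d → ℤ) → ℝ

/-- The monomial `φ ↦ ∏ i, φ (x i)` of degree `k` attached to `x : [k] → I`. -/
def monomial {d k : ℕ} (x : Fin k → (Fin d → ℤ)) (φ : Config d) : ℝ := ∏ i, φ (x i)

/-- Under a Gaussian distribution every monomial is square integrable. -/
theorem memLp_monomial (𝕜 : Type*) [RCLike 𝕜] {d : ℕ} (P : Measure (Config d)) [IsGaussian P]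
    {k : ℕ} (x : Fin k → (Fin d → ℤ)) :
    MemLp (fun φ : Config d => ((monomial x φ : ℝ) : 𝕜)) 2 P := by
  have hcoord : ∀ (n : Fin d → ℤ) (p : ENNReal), p ≠ ⊤ →
      MemLp (fun φ : Config d => φ n) p P := by
    intro n p hp
    have hm := IsGaussian.map_eq_gaussianReal (μ := P)
      (ContinuousLinearMap.proj n : StrongDual ℝ (Config d))
    have hid := memLp_id_gaussianReal' (μ := P[(ContinuousLinearMap.proj n :
      StrongDual ℝ (Config d))]) (v := (variance (ContinuousLinearMap.proj n :
      StrongDual ℝ (Config d)) P).toNNReal) p hp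
    rw [← hm] at hid
    exact hid.comp_of_map (measurable_pi_apply n).aemeasurable
  have hreal : MemLp (fun φ : Config d => monomial x φ) 2 P := by
    rcases Nat.eq_zero_or_pos k with rfl | hk
    · simpa [monomial] using (memLp_const (1 : ℝ) : MemLp (fun _ : Config d => (1 : ℝ)) 2 P)
    · have h := MemLp.prod' (μ := P) (s := (Finset.univ : Finset (Fin k)))
        (f := fun i (φ : Config d) => φ (x i)) (p := fun _ => 2 * k)
        (fun i _ => hcoord (x i) (2 * k) (by finiteness))
      have hk0 : (k : ENNReal) ≠ 0 := by exact_mod_cast hk.ne'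
      have e : (∑ _i : Fin k, (2 * (k : ENNReal))⁻¹)⁻¹ = 2 := by
        rw [Finset.sum_const, Finset.card_univ, Fintype.card_fin, nsmul_eq_mul,
          ENNReal.mul_inv (Or.inl two_ne_zero) (Or.inl (by finiteness)), mul_left_comm,
          ENNReal.mul_inv_cancel hk0 (by finiteness), mul_one, inv_inv]
      rw [e] at h
      exact h
  exact hreal.ofReal

/-- The class in `L²(E, P)` of the monomial attached to `x`. -/
noncomputable def monomialLp (𝕜 : Type*) [RCLike 𝕜] {d : ℕ} (P : Measure (Config d))
    [IsGaussian P] {k : ℕ} (x : Fin k → (Fin d → ℤ)) : Lp 𝕜 2 P :=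
  (memLp_monomial 𝕜 P x).toLp (fun φ : Config d => ((monomial x φ : ℝ) : 𝕜))

/-- `H(m)`: the Hilbert subspace of `L²(E, P)` generated by the monomials of degree at most `m`.
The index is an integer, so that `H(-1)` is generated by the empty family, i.e. `H(-1) = 0`. -/
noncomputable def H (𝕜 : Type*) [RCLike 𝕜] {d : ℕ} (P : Measure (Config d)) [IsGaussian P]
    (m : ℤ) : Submodule 𝕜 (Lp 𝕜 2 P) :=
  (Submodule.span 𝕜 {f : Lp 𝕜 2 P |
    ∃ (k : ℕ) (x : Fin k → (Fin d → ℤ)), (k : ℤ) ≤ m ∧ f = monomialLp 𝕜 P x}).topologicalClosure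

/-- `S_m = H(m) ∩ H(m - 1)ᗮ`. -/
noncomputable def S (𝕜 : Type*) [RCLike 𝕜] {d : ℕ} (P : Measure (Config d)) [IsGaussian P]
    (m : ℕ) : Submodule 𝕜 (Lp 𝕜 2 P) :=
  H 𝕜 P m ⊓ (H 𝕜 P ((m : ℤ) - 1))ᗮ

/-- `V` is the closed orthogonal sum of the family `W` of Hilbert subspaces: the `W a` are closed
and pairwise orthogonal, and `V` is the closure of their sum. -/
structure IsClosedOrthogonalSum {𝕜 F ι : Type*} [RCLike 𝕜] [NormedAddCommGroup F]
    [InnerProductSpace 𝕜 F] (W : ι → Submodule 𝕜 F) (V : Submodule 𝕜 F) : Prop where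
  isClosed : ∀ a, IsClosed (W a : Set F)
  orthogonal : ∀ a b, a ≠ b → W a ⟂ W b
  eq_closure : V = (⨆ a, W a).topologicalClosure

end GaussianChaos

namespace GaussianChaos

/-! ### Totality of the monomials -/

section Density

variable {d : ℕ} {P : Measure (Config d)} [IsGaussian P]

/-! Each `S m` is the orthogonal complement of `H (m - 1)` in `H m`, so the finite decompositions
telescope from `H (-1) = 0`. The analytic content is totality, `eq_zero_of_inner_monomialLp`. Let a
real `h` in L² be orthogonal to all monomials. Gaussian exponential moments allow the series of `exp
(iL)` to be integrated termwise against `h`, so `h` annihilates all finite-dimensional characters.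
The finite measures `h⁺P` and `h⁻P` then have equal marginals, hence coincide, and `h = 0` a.e. -/

theorem memLp_monomial_real {k : ℕ} (x : Fin k → (Fin d → ℤ)) : MemLp (monomial x) 2 P :=
  memLp_monomial ℝ P x

/-- A continuous linear functional has exponential moments of all orders under a Gaussian law. -/
theorem memLp_exp_abs_dual (L : StrongDual ℝ (Config d)) :
    MemLp (fun φ => Real.exp |L φ|) 2 P := by
  have hL : Measurable (L : Config d → ℝ) := L.continuous.measurable
  have hint (t : ℝ) : Integrable (fun φ => Real.exp (t * L φ)) P := by
    have h := integrable_exp_mul_gaussianReal (μ := P[L]) (v := Var[L; P].toNNReal) t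
    rw [← IsGaussian.map_eq_gaussianReal] at h
    exact h.comp_measurable hL
  rw [memLp_two_iff_integrable_sq (by fun_prop)]
  -- Squaring doubles the exponent; `exp (2|L|) ≤ exp (2L) + exp (-2L)`.
  refine (integrable_exp_mul_abs (hint 2) (hint (-2))).congr (.of_forall fun φ => ?_)
  simp only
  rw [← Real.exp_nat_mul]
  norm_num

/-- The restriction of a configuration to finitely many sites, followed by a linear functional. -/
noncomputable def restrictDual (J : Finset (Fin d → ℤ)) (L : StrongDual ℝ (J → ℝ)) :
    StrongDual ℝ (Config d) :=
  L.comp (ContinuousLinearMap.pi fun j : J => ContinuousLinearMap.proj (j : Fin d → ℤ))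

theorem restrictDual_apply (J : Finset (Fin d → ℤ)) (L : StrongDual ℝ (J → ℝ)) (φ : Config d) :
    restrictDual J L φ = L (J.restrict φ) := rfl

theorem restrictDual_eq_sum (J : Finset (Fin d → ℤ)) (L : StrongDual ℝ (J → ℝ)) (φ : Config d) :
    restrictDual J L φ = ∑ j : J, L (Pi.single j 1) * φ j := by
  classical
  have h : (J.restrict φ) = ∑ j : J, φ j • (Pi.single j (1 : ℝ) : J → ℝ) := by
    ext j
    simp [Finset.sum_apply, Pi.single_apply]
  rw [restrictDual_apply, h, map_sum]
  simp [mul_comm]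

/-- Expanding the power of the sum over sites leaves finitely many monomials of degree `n`. -/
theorem integrable_mul_restrictDual_pow {h : Config d → ℝ} (hh : MemLp h 2 P)
    (J : Finset (Fin d → ℤ)) (L : StrongDual ℝ (J → ℝ)) (n : ℕ) :
    Integrable (fun φ => h φ * restrictDual J L φ ^ n) P ∧
      ((∀ (k : ℕ) (x : Fin k → (Fin d → ℤ)), ∫ φ, h φ * monomial x φ ∂P = 0) →
        ∫ φ, h φ * restrictDual J L φ ^ n ∂P = 0) := by
  have hexp (φ : Config d) : h φ * restrictDual J L φ ^ n =
      ∑ p : Fin n → J, (∏ i, L (Pi.single (p i) 1)) *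
        (h φ * monomial (fun i => (p i : Fin d → ℤ)) φ) := by
    rw [restrictDual_eq_sum, Fintype.sum_pow, Finset.mul_sum]
    refine Finset.sum_congr rfl fun p _ => ?_
    rw [Finset.prod_mul_distrib, monomial]
    ring
  have hint (p : Fin n → J) : Integrable (fun φ => (∏ i, L (Pi.single (p i) 1)) *
      (h φ * monomial (fun i => (p i : Fin d → ℤ)) φ)) P :=
    (hh.integrable_mul (memLp_monomial_real _)).const_mul _
  simp_rw [hexp]
  refine ⟨integrable_finsetSum _ fun p _ => hint p, fun h0 => ?_⟩
  rw [integral_finsetSum _ fun p _ => hint p]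
  refine Finset.sum_eq_zero fun p _ => ?_
  rw [integral_const_mul, h0, mul_zero]

/-- A square integrable function orthogonal to all monomials is orthogonal to the characters
of finite-dimensional marginals. -/
theorem integral_mul_cexp_eq_zero {h : Config d → ℝ} (hh : MemLp h 2 P)
    (h0 : ∀ (k : ℕ) (x : Fin k → (Fin d → ℤ)), ∫ φ, h φ * monomial x φ ∂P = 0)
    (J : Finset (Fin d → ℤ)) (L : StrongDual ℝ (J → ℝ)) :
    ∫ φ, (h φ : ℂ) * Complex.exp (restrictDual J L φ * Complex.I) ∂P = 0 := by
  have hterm (φ : Config d) (k : ℕ) :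
      (h φ : ℂ) * ((restrictDual J L φ * Complex.I) ^ k / (k.factorial : ℂ)) =
        (Complex.I ^ k / k.factorial) * ((h φ * restrictDual J L φ ^ k : ℝ) : ℂ) := by
    push_cast
    ring
  have hint (k : ℕ) : Integrable (fun φ =>
      (h φ : ℂ) * ((restrictDual J L φ * Complex.I) ^ k / (k.factorial : ℂ))) P := by
    simp_rw [hterm]
    exact ((integrable_mul_restrictDual_pow hh J L k).1.ofReal (𝕜 := ℂ)).const_mul _
  have hzero (n : ℕ) : ∫ φ, (h φ : ℂ) * ∑ k ∈ Finset.range n,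
      (restrictDual J L φ * Complex.I) ^ k / (k.factorial : ℂ) ∂P = 0 := by
    simp_rw [Finset.mul_sum]
    rw [integral_finsetSum _ fun k _ => hint k]
    refine Finset.sum_eq_zero fun k _ => ?_
    simp_rw [hterm]
    rw [integral_const_mul, integral_complex_ofReal,
      (integrable_mul_restrictDual_pow hh J L k).2 h0]
    simp
  have hlim : Filter.Tendsto (fun n : ℕ => ∫ φ, (h φ : ℂ) * ∑ k ∈ Finset.range n,
      (restrictDual J L φ * Complex.I) ^ k / (k.factorial : ℂ) ∂P) Filter.atTop
      (nhds (∫ φ, (h φ : ℂ) * Complex.exp (restrictDual J L φ * Complex.I) ∂P)) := by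
    -- The partial sums are bounded by `exp |L|`, whose product with `|h|` is integrable since both
    -- are in L².
    refine tendsto_integral_of_dominated_convergence
      (fun φ => |h φ| * Real.exp |restrictDual J L φ|) (fun n => ?_)
      (hh.abs.integrable_mul (memLp_exp_abs_dual _)) (fun n => .of_forall fun φ => ?_)
      (.of_forall fun φ => ?_)
    · simp_rw [Finset.mul_sum]
      exact (integrable_finsetSum _ fun k _ => hint k).aestronglyMeasurable
    · rw [norm_mul, Complex.norm_real, Real.norm_eq_abs]
      gcongr
      refine (norm_sum_le _ _).trans ?_
      refine le_trans (le_of_eq ?_) (Real.sum_le_exp_of_nonneg (abs_nonneg _) n)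
      simp
    · refine Filter.Tendsto.const_mul _ ?_
      rw [Complex.exp_eq_exp_ℂ]
      exact (NormedSpace.expSeries_div_hasSum_exp
        ((restrictDual J L φ : ℂ) * Complex.I)).tendsto_sum_nat
  simp_rw [hzero] at hlim
  exact tendsto_nhds_unique hlim tendsto_const_nhds

/-- `ENNReal.ofReal` truncates negative values, so the densities `h` and `-h` yield `h⁺` and `h⁻`.
-/
theorem integral_withDensity_ofReal {α : Type*} {_ : MeasurableSpace α} {μ : Measure α}
    {g : α → ℝ} (hg : AEMeasurable g μ) (f : α → ℂ) :
    ∫ a, f a ∂(μ.withDensity fun a => ENNReal.ofReal (g a)) = ∫ a, (max (g a) 0 : ℝ) * f a ∂μ := by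
  rw [integral_withDensity_eq_integral_toReal_smul₀ hg.ennreal_ofReal
    (.of_forall fun _ => ENNReal.ofReal_lt_top)]
  refine integral_congr_ae (.of_forall fun a => ?_)
  simp [ENNReal.toReal_ofReal']

/-- Totality of the monomials, for real functions. -/
theorem ae_eq_zero_of_integral_mul_monomial {h : Config d → ℝ} (hh : MemLp h 2 P)
    (h0 : ∀ (k : ℕ) (x : Fin k → (Fin d → ℤ)), ∫ φ, h φ * monomial x φ ∂P = 0) :
    h =ᵐ[P] 0 := by
  have hm : AEMeasurable h P := hh.1.aemeasurable
  have hi : Integrable h P := hh.integrable (by norm_num)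
  set μ := P.withDensity fun φ => ENNReal.ofReal (h φ) with hμ
  set ν := P.withDensity fun φ => ENNReal.ofReal (-h φ) with hν
  have : IsFiniteMeasure μ := isFiniteMeasure_withDensity_ofReal hi.2
  have : IsFiniteMeasure ν := isFiniteMeasure_withDensity_ofReal hi.neg.2
  have hmarg (J : Finset (Fin d → ℤ)) : μ.map J.restrict = ν.map J.restrict := by
    refine Measure.ext_of_charFunDual (funext fun L => ?_)
    have hmeas : Measurable (fun y : J → ℝ => Complex.exp (L y * Complex.I)) := by fun_prop
    rw [charFunDual_apply, charFunDual_apply,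
      integral_map (by fun_prop) hmeas.aestronglyMeasurable,
      integral_map (by fun_prop) hmeas.aestronglyMeasurable, hμ, hν,
      integral_withDensity_ofReal hm,
      integral_withDensity_ofReal (g := fun φ => -h φ) hm.neg, ← sub_eq_zero]
    have hb (g : Config d → ℝ) (hg : Integrable g P) :
        Integrable (fun φ => (g φ : ℂ) * Complex.exp (L (J.restrict φ) * Complex.I)) P := by
      refine (hg.ofReal (𝕜 := ℂ)).mul_bdd (c := 1) ?_ (.of_forall fun φ => ?_)
      · exact (hmeas.comp (by fun_prop)).aestronglyMeasurable
      · rw [Complex.norm_exp_ofReal_mul_I]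
    rw [← integral_sub (hb _ hi.pos_part) (hb _ hi.neg_part),
      ← integral_mul_cexp_eq_zero hh h0 J L]
    refine integral_congr_ae (.of_forall fun φ => ?_)
    simp only [restrictDual_apply]
    rw [← sub_mul, ← Complex.ofReal_sub]
    congr 2
    rcases le_total (h φ) 0 with hφ | hφ
    · rw [max_eq_right hφ, max_eq_left (by linarith)]; ring
    · rw [max_eq_left hφ, max_eq_right (by linarith)]; ring
  have heq : μ = ν := by
    have (J : Finset (Fin d → ℤ)) : IsFiniteMeasure (ν.map J.restrict) := inferInstance
    exact IsProjectiveLimit.unique (P := fun J => ν.map J.restrict) hmarg fun _ => rfl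
  -- Equal measures give `h⁺ = h⁻` a.e.; one of the two always vanishes, so both do.
  have hae := (withDensity_eq_iff hm.ennreal_ofReal hm.neg.ennreal_ofReal
    hi.lintegral_lt_top.ne).1 heq
  filter_upwards [hae] with φ hφ
  have h1 := congrArg ENNReal.toReal hφ
  simp only [ENNReal.toReal_ofReal'] at h1
  rcases le_total (h φ) 0 with h2 | h2
  · rw [max_eq_right h2, max_eq_left (by simpa using h2)] at h1
    simpa using h1.symm
  · rw [max_eq_left h2, max_eq_right (by simpa using h2)] at h1
    simpa using h1

/-- Totality of the monomials in `L²(E, P)`. -/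
theorem eq_zero_of_inner_monomialLp {𝕜 : Type*} [RCLike 𝕜] {f : Lp 𝕜 2 P}
    (hf : ∀ (k : ℕ) (x : Fin k → (Fin d → ℤ)), inner 𝕜 (monomialLp 𝕜 P x) f = 0) : f = 0 := by
  have hint (k : ℕ) (x : Fin k → (Fin d → ℤ)) :
      Integrable (fun φ => f φ * ((monomial x φ : ℝ) : 𝕜)) P :=
    (Lp.memLp f).integrable_mul (memLp_monomial 𝕜 P x)
  have hzero (k : ℕ) (x : Fin k → (Fin d → ℤ)) :
      ∫ φ, f φ * ((monomial x φ : ℝ) : 𝕜) ∂P = 0 := by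
    rw [← hf k x, L2.inner_def]
    refine integral_congr_ae ?_
    filter_upwards [(memLp_monomial 𝕜 P x).coeFn_toLp] with φ hφ
    rw [monomialLp, hφ, RCLike.inner_apply, RCLike.conj_ofReal]
  -- Monomials are real, so the real and imaginary parts of `f` are separately orthogonal to them.
  have hre := ae_eq_zero_of_integral_mul_monomial (Lp.memLp f).re fun k x => by
    have h := integral_re (hint k x)
    rw [hzero] at h
    simpa using h
  have him := ae_eq_zero_of_integral_mul_monomial (Lp.memLp f).im fun k x => by
    have h := integral_im (hint k x)
    rw [hzero] at h
    simpa using h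
  rw [Lp.eq_zero_iff_ae_eq_zero]
  filter_upwards [hre, him] with φ h1 h2
  exact RCLike.ext (by simpa using h1) (by simpa using h2)

end Density

/-! ### Hilbert space geometry of the degree filtration -/

section Decomposition

variable (𝕜 : Type*) [RCLike 𝕜] {d : ℕ} (P : Measure (Config d)) [IsGaussian P]

theorem isClosed_H (m : ℤ) : IsClosed (H 𝕜 P m : Set (Lp 𝕜 2 P)) :=
  Submodule.isClosed_topologicalClosure _

theorem H_mono : Monotone (H 𝕜 P) := fun _ _ hmn =>
  Submodule.topologicalClosure_mono <| Submodule.span_mono fun _ ⟨k, x, hk, hf⟩ =>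
    ⟨k, x, hk.trans hmn, hf⟩

theorem monomialLp_mem_H {k : ℕ} (x : Fin k → (Fin d → ℤ)) : monomialLp 𝕜 P x ∈ H 𝕜 P k :=
  Submodule.le_topologicalClosure _ (Submodule.subset_span ⟨k, x, le_rfl, rfl⟩)

theorem H_of_neg {m : ℤ} (hm : m < 0) : H 𝕜 P m = ⊥ := by
  have h : {f : Lp 𝕜 2 P |
      ∃ (k : ℕ) (x : Fin k → (Fin d → ℤ)), (k : ℤ) ≤ m ∧ f = monomialLp 𝕜 P x} = ∅ :=
    Set.eq_empty_of_forall_notMem fun f ⟨k, _, hk, _⟩ => by omega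
  rw [H, h, Submodule.span_empty]
  exact isClosed_singleton.submodule_topologicalClosure_eq

theorem isClosed_S (m : ℕ) : IsClosed (S 𝕜 P m : Set (Lp 𝕜 2 P)) :=
  (isClosed_H 𝕜 P m).inter (Submodule.isClosed_orthogonal _)

theorem S_le_H (m : ℕ) : S 𝕜 P m ≤ H 𝕜 P m := inf_le_left

theorem isOrtho_S_of_lt {a b : ℕ} (hab : a < b) : S 𝕜 P a ⟂ S 𝕜 P b :=
  ((Submodule.isOrtho_orthogonal_right _).mono_right inf_le_right).mono_left
    ((S_le_H 𝕜 P a).trans (H_mono 𝕜 P (by omega)))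

theorem isOrtho_S {a b : ℕ} (hab : a ≠ b) : S 𝕜 P a ⟂ S 𝕜 P b :=
  hab.lt_or_gt.elim (isOrtho_S_of_lt 𝕜 P) fun h => (isOrtho_S_of_lt 𝕜 P h).symm

theorem H_sub_one_sup_S (m : ℕ) : H 𝕜 P ((m : ℤ) - 1) ⊔ S 𝕜 P m = H 𝕜 P m := by
  have : CompleteSpace (H 𝕜 P ((m : ℤ) - 1)) := (isClosed_H 𝕜 P _).completeSpace_coe
  rw [S, inf_comm]
  exact Submodule.sup_orthogonal_inf_of_hasOrthogonalProjection (H_mono 𝕜 P (by omega))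

/-- The sum of the `S k` for `k ≤ m` is `H m`, even before taking the closure. -/
theorem iSup_S_eq_H (m : ℕ) : ⨆ k : {k : ℕ // k ≤ m}, S 𝕜 P k = H 𝕜 P m := by
  refine le_antisymm (iSup_le fun k => (S_le_H 𝕜 P k).trans
    (H_mono 𝕜 P (by exact_mod_cast k.2))) ?_
  induction m with
  | zero =>
    -- The integer index makes this `H (-1) = 0`, so `S 0 = H 0`.
    rw [← H_sub_one_sup_S, H_of_neg 𝕜 P (by simp), bot_sup_eq]
    exact le_iSup (fun k : {k : ℕ // k ≤ 0} => S 𝕜 P k) ⟨0, le_rfl⟩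
  | succ m ih =>
    rw [← H_sub_one_sup_S]
    refine sup_le ?_ (le_iSup (fun k : {k : ℕ // k ≤ m + 1} => S 𝕜 P k) ⟨m + 1, le_rfl⟩)
    rw [Nat.cast_succ, add_sub_cancel_right]
    exact ih.trans (iSup_le fun k =>
      le_iSup (fun k : {k : ℕ // k ≤ m + 1} => S 𝕜 P k) ⟨k, k.2.trans m.le_succ⟩)

/-- The sum contains every `H k`, hence every monomial, so totality kills its orthogonal complement.
-/
theorem topologicalClosure_iSup_S : (⨆ m : ℕ, S 𝕜 P m).topologicalClosure = ⊤ := by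
  rw [Submodule.topologicalClosure_eq_top_iff, Submodule.eq_bot_iff]
  refine fun f hf => eq_zero_of_inner_monomialLp fun k x => hf _ ?_
  have h := monomialLp_mem_H 𝕜 P x
  rw [← iSup_S_eq_H] at h
  exact iSup_le (fun j : {j : ℕ // j ≤ k} => le_iSup (fun m : ℕ => S 𝕜 P m) j) h

end Decomposition

end GaussianChaos

theorem mainTheorem7 {𝕜 : Type*} [RCLike 𝕜] (d : ℕ)
    (P : MeasureTheory.Measure (GaussianChaos.Config d)) [ProbabilityTheory.IsGaussian P] :
    (∀ m : ℕ, GaussianChaos.IsClosedOrthogonalSum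
      (fun k : {k : ℕ // k ≤ m} => GaussianChaos.S 𝕜 P (k : ℕ)) (GaussianChaos.H 𝕜 P (m : ℤ))) ∧
    GaussianChaos.IsClosedOrthogonalSum
      (fun m : ℕ => GaussianChaos.S 𝕜 P m) (⊤ : Submodule 𝕜 (MeasureTheory.Lp 𝕜 2 P)) := by
  refine ⟨fun m => ⟨fun k => GaussianChaos.isClosed_S 𝕜 P k,
    fun a b hab => GaussianChaos.isOrtho_S 𝕜 P fun h => hab (Subtype.ext h), ?_⟩,
    fun m => GaussianChaos.isClosed_S 𝕜 P m, fun a b hab => GaussianChaos.isOrtho_S 𝕜 P hab,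
    (GaussianChaos.topologicalClosure_iSup_S 𝕜 P).symm⟩
  rw [GaussianChaos.iSup_S_eq_H]
  exact (GaussianChaos.isClosed_H 𝕜 P m).submodule_topologicalClosure_eq.symm
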